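/- Let $N\ge 0$ be an integer. A GARK-ROS method (partitioned Rosenbrock method with exact component Jacobians) is given by stage numbers $s^{\{q\}}$, weight vectors $b^{\{q\}}\in\mathbb R^{s^{\{q\}}}$, strictly lower triangular matrices $\alpha^{\{q,m\}}$ and lower triangular matrices $\gamma^{\{q,m\}}$ in $\mathbb R^{s^{\{q\}}\times s^{\{m\}}}$, $1\le q,m\le N$. Put $\beta^{\{q,m\}}=\alpha^{\{q,m\}}+\gamma^{\{q,m\}}$. One step of size $h$ from $y_n\in\mathbb R^d$, applied to the system $y'=\sum_{m=1}^N f^{\{m\}}(y)$ with smooth ($C^\infty$) functions $f^{\{m\}}:\mathbb R^d\to\mathbb R^d$, is $$k^{\{q\}}_i=h\,f^{\{q\}}\Big(y_n+\sum_{m=1}^N\sum_{j}\alpha^{\{q,m\}}_{i,j}k^{\{m\}}_j\Big)+h\,J_n^{\{q\}}\sum_{m=1}^N\sum_{j}\gamma^{\{q,m\}}_{i,j}k^{\{m\}}_j\quad(1\le q\le N,\ 1\le i\le s^{\{q\}}),$$ $$y_{n+1}=y_n+\sum_{q=1}^N\sum_{i=1}^{s^{\{q\}}}b_i^{\{q\}}k_i^{\{q\}},$$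 where $J_n^{\{q\}}$ is the Jacobian of $f^{\{q\}}$ at $y_n$. The method has order of consistency (at least) $p$ if for every $d$, every such system and every exact solution $y$ on an interval $[t_0,t_F]$ with $t_0<t_F$, for all sufficiently small $h>0$ the step from $y(t_0)$ exists and its results $y_1$ satisfy $y(t_0+h)-y_1=O(h^{p+1})$ as $h\to0^+$. Let $\mathbb T_N$ be the set of (unordered) rooted trees whose vertices are colored in the colors $1,\dots,N$. Write $[t_1,\dots,t_L]_m$ for the tree obtained by attaching the nonempty trees $t_1,\dots,t_L$ to a root of color $m$, and $\tau_m$ for the single vertex of color $m$ (the case $L=0$). Let $\rho(t)$ be the number of vertices of $t$, and let the density be $\gamma(\tau_m)=1$ and $\gamma([t_1,\dots,t_L]_m)=\rho([t_1,\dots,t_L]_m)\,\gamma(t_1)\cdots\gamma(t_L)$. Define vectors $\theta^{\{q\}}(t)\in\mathbb R^{s^{\{q\}}}$ for nonempty $t\in\mathbb T_N$ recursively by $$\theta^{\{q\}}(t)=\begin{cases}(1,\dots,1)^T,& t=\tau_q,\\ \sum_{m=1}^N\beta^{\{q,m\}}\theta^{\{m\}}(t_1),& t=[t_1]_q,\\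 \prod_{\ell=1}^L\Big(\sum_{m=1}^N\alpha^{\{q,m\}}\theta^{\{m\}}(t_\ell)\Big),& t=[t_1,\dots,t_L]_q,\ L\ge2,\\ 0,&\text{if the root of } t \text{ does not have color } q,\end{cases}$$ where the product over $\ell$ is element by element. **Theorem (GARK-ROS order conditions).** Let $p\ge0$ be an integer. A GARK-ROS method has order of consistency $p$ if and only if $$\sum_{m=1}^N b^{\{m\}T}\,\theta^{\{m\}}(t)=\frac1{\gamma(t)}\qquad\text{for all } t\in\mathbb T_N \text{ with } 1\le\rho(t)\le p.$$ -/

import Mathlib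

namespace GarkRos

open scoped ContDiff

/-! ### Partitioned Rosenbrock methods -/

/-- A GARK-ROS method with `N` partitions and `s q` stages for the `q`-th component:
weights `b q`, strictly lower triangular matrices `α q m` and lower triangular matrices `γ q m`,
both of size `s q × s m`. -/
structure Method (N : ℕ) (s : Fin N → ℕ) where
  b : (q : Fin N) → Fin (s q) → ℝ
  α : (q m : Fin N) → Matrix (Fin (s q)) (Fin (s m)) ℝ
  γ : (q m : Fin N) → Matrix (Fin (s q)) (Fin (s m)) ℝ
  α_strictLower : ∀ q m (i : Fin (s q)) (j : Fin (s m)), (i : ℕ) ≤ (j : ℕ) → α q m i j = 0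
  γ_lower : ∀ q m (i : Fin (s q)) (j : Fin (s m)), (i : ℕ) < (j : ℕ) → γ q m i j = 0

/-- `β = α + γ`. -/
def Method.β {N : ℕ} {s : Fin N → ℕ} (M : Method N s) (q m : Fin N) :
    Matrix (Fin (s q)) (Fin (s m)) ℝ :=
  M.α q m + M.γ q m

/-- The increments `k q i` solve the stage equations with component functions `f q`, step size `h`
and current value `y₀`; the exact Jacobian of `f q` is evaluated at `y₀`. -/
def Method.IsStage {N : ℕ} {s : Fin N → ℕ} (M : Method N s) {d : ℕ}
    (f : Fin N → EuclideanSpace ℝ (Fin d) → EuclideanSpace ℝ (Fin d))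
    (y₀ : EuclideanSpace ℝ (Fin d)) (h : ℝ)
    (k : (q : Fin N) → Fin (s q) → EuclideanSpace ℝ (Fin d)) : Prop :=
  ∀ (q : Fin N) (i : Fin (s q)),
    k q i = h • f q (y₀ + ∑ m : Fin N, ∑ j : Fin (s m), M.α q m i j • k m j)
      + h • fderiv ℝ (f q) y₀ (∑ m : Fin N, ∑ j : Fin (s m), M.γ q m i j • k m j)

/-- `y₁` is a result of one step of size `h` of the method started at `y₀`. -/
def Method.IsStep {N : ℕ} {s : Fin N → ℕ} (M : Method N s) {d : ℕ}
    (f : Fin N → EuclideanSpace ℝ (Fin d) → EuclideanSpace ℝ (Fin d))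
    (y₀ : EuclideanSpace ℝ (Fin d)) (h : ℝ) (y₁ : EuclideanSpace ℝ (Fin d)) : Prop :=
  ∃ k : (q : Fin N) → Fin (s q) → EuclideanSpace ℝ (Fin d),
    M.IsStage f y₀ h k ∧ y₁ = y₀ + ∑ q : Fin N, ∑ i : Fin (s q), M.b q i • k q i

/-- Order of consistency (at least) `p`: for all smooth additively partitioned systems
`y' = ∑ m, f m y`, in every dimension, and every exact solution `y` on `[t₀, tF]`, one step of the
method started at `y t₀` is defined for all small `h > 0`, and its local error
`y (t₀ + h) - y₁` is `O(h ^ (p + 1))` as `h` tends to zero from above. -/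
def Method.HasOrder {N : ℕ} {s : Fin N → ℕ} (M : Method N s) (p : ℕ) : Prop :=
  ∀ (d : ℕ) (f : Fin N → EuclideanSpace ℝ (Fin d) → EuclideanSpace ℝ (Fin d)),
    (∀ m, ContDiff ℝ ∞ (f m)) →
    ∀ (t₀ tF : ℝ) (y : ℝ → EuclideanSpace ℝ (Fin d)), t₀ < tF →
      (∀ t ∈ Set.Icc t₀ tF,
        HasDerivWithinAt y (∑ m : Fin N, f m (y t)) (Set.Icc t₀ tF) t) →
      ∃ C : ℝ, ∀ᶠ h : ℝ in nhdsWithin 0 (Set.Ioi 0),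
        (∃ y₁, M.IsStep f (y t₀) h y₁) ∧
        ∀ y₁, M.IsStep f (y t₀) h y₁ → ‖y (t₀ + h) - y₁‖ ≤ C * h ^ (p + 1)

/-! ### Coloured rooted trees -/

/-- Rooted trees with vertices coloured in `N` colours, the children of each vertex being listed
in some order. `node m n ch` has a root of colour `m` with the `n` subtrees `ch ℓ` attached. -/
inductive PlaneTree (N : ℕ) : Type
  | node (m : Fin N) (n : ℕ) (children : Fin n → PlaneTree N) : PlaneTree N

/-- Isomorphism of coloured rooted trees: the order of the children is irrelevant. -/
inductive PlaneTree.Iso {N : ℕ} : PlaneTree N → PlaneTree N → Prop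
  | node (m : Fin N) (n : ℕ) (ch ch' : Fin n → PlaneTree N) (e : Equiv.Perm (Fin n))
      (h : ∀ ℓ, PlaneTree.Iso (ch ℓ) (ch' (e ℓ))) :
      PlaneTree.Iso (.node m n ch) (.node m n ch')

theorem PlaneTree.Iso.refl {N : ℕ} (t : PlaneTree N) : t.Iso t := by
  induction t with
  | node m n ch ih => exact .node m n ch ch (Equiv.refl _) ih

theorem PlaneTree.Iso.symm {N : ℕ} {t u : PlaneTree N} (h : t.Iso u) : u.Iso t := by
  induction h with
  | node m n ch ch' e _ ih =>
    refine .node m n ch' ch e.symm fun ℓ => ?_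
    simpa using ih (e.symm ℓ)

theorem PlaneTree.Iso.trans {N : ℕ} {t u v : PlaneTree N} (h : t.Iso u) (h' : u.Iso v) :
    t.Iso v := by
  induction h generalizing v with
  | node m n ch ch' e _ ih =>
    cases h' with
    | node _ _ _ ch'' e' h'' => exact .node m n ch ch'' (e.trans e') fun ℓ => ih ℓ (h'' (e ℓ))

instance PlaneTree.setoid (N : ℕ) : Setoid (PlaneTree N) :=
  ⟨PlaneTree.Iso, PlaneTree.Iso.refl, PlaneTree.Iso.symm, PlaneTree.Iso.trans⟩

/-- The nonempty trees of the set `𝕋_N` of (unordered) rooted trees coloured in `N` colours. -/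
def Tree (N : ℕ) : Type :=
  Quotient (PlaneTree.setoid N)

/-- The number of vertices. -/
def PlaneTree.order {N : ℕ} : PlaneTree N → ℕ
  | .node _ n ch => 1 + ∑ ℓ : Fin n, (ch ℓ).order

/-- The density `γ([t₁, …, t_L]) = ρ([t₁, …, t_L]) γ(t₁) ⋯ γ(t_L)`; a single vertex has
density `1`. -/
def PlaneTree.density {N : ℕ} : PlaneTree N → ℕ
  | .node m n ch => (PlaneTree.node m n ch).order * ∏ ℓ : Fin n, (ch ℓ).density

/-- The vectors `θ^{q}(t)`, indexed by `q`, of coefficients of the stages. -/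
noncomputable def Method.planeTheta {N : ℕ} {s : Fin N → ℕ} (M : Method N s) :
    PlaneTree N → (q : Fin N) → Fin (s q) → ℝ
  | .node c 0 _, q => if c = q then 1 else 0
  | .node c 1 ch, q =>
      if c = q then ∑ m : Fin N, (M.β q m).mulVec (M.planeTheta (ch 0) m) else 0
  | .node c (n + 2) ch, q =>
      if c = q then
        ∏ ℓ : Fin (n + 2), ∑ m : Fin N, (M.α q m).mulVec (M.planeTheta (ch ℓ) m)
      else 0

theorem PlaneTree.Iso.order_eq {N : ℕ} {t u : PlaneTree N} (h : t.Iso u) :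
    t.order = u.order := by
  induction h with
  | node m n ch ch' e _ ih =>
    simp only [PlaneTree.order, ih]
    rw [Equiv.sum_comp e (fun ℓ => (ch' ℓ).order)]

theorem PlaneTree.Iso.density_eq {N : ℕ} {t u : PlaneTree N} (h : t.Iso u) :
    t.density = u.density := by
  induction h with
  | node m n ch ch' e h ih =>
    rw [PlaneTree.density, PlaneTree.density, (PlaneTree.Iso.node m n ch ch' e h).order_eq]
    simp only [ih]
    rw [Equiv.prod_comp e (fun ℓ => (ch' ℓ).density)]

theorem Method.planeTheta_eq {N : ℕ} {s : Fin N → ℕ} (M : Method N s) {t u : PlaneTree N}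
    (h : t.Iso u) : M.planeTheta t = M.planeTheta u := by
  induction h with
  | node c n ch ch' e _ ih =>
    funext q
    match n, ch, ch', e, ih with
    | 0, _, _, _, _ => simp only [Method.planeTheta]
    | 1, ch, ch', e, ih =>
      simp only [Method.planeTheta, ih]
      rw [Subsingleton.elim (e 0) 0]
    | n + 2, ch, ch', e, ih =>
      simp only [Method.planeTheta, ih]
      rw [Equiv.prod_comp e
        (fun ℓ => ∑ m : Fin N, (M.α q m).mulVec (M.planeTheta (ch' ℓ) m))]

/-- The order `ρ(t)`: the number of vertices of `t`. -/
def Tree.order {N : ℕ} (t : Tree N) : ℕ :=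
  Quotient.lift PlaneTree.order (fun _ _ h => PlaneTree.Iso.order_eq h) t

/-- The density `γ(t)`. -/
def Tree.density {N : ℕ} (t : Tree N) : ℕ :=
  Quotient.lift PlaneTree.density (fun _ _ h => PlaneTree.Iso.density_eq h) t

/-- The vector `θ^{q}(t) ∈ ℝ^{s q}`. -/
noncomputable def Method.theta {N : ℕ} {s : Fin N → ℕ} (M : Method N s) (q : Fin N)
    (t : Tree N) : Fin (s q) → ℝ :=
  Quotient.lift M.planeTheta (fun _ _ h => M.planeTheta_eq h) t q

end GarkRos

open Filter Asymptotics Topology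
open scoped ContDiff

namespace GarkRos

/-! ### Taylor expansion along lines -/

section Taylor

variable {E F : Type*} [NormedAddCommGroup E] [NormedSpace ℝ E]
  [NormedAddCommGroup F] [NormedSpace ℝ F]

/-! The exact solution and the stages expand in the same elementary differentials, indexed by
coloured trees. The tree `t` has coefficient `h ^ ρ(t) / γ(t)` in the exact solution and `h ^ ρ(t) *
θ(t)` in a stage, so the local error expands with coefficients `1 / γ(t) - ∑ bᵀ θ(t)`.

Both expansions come from bootstrapping: a truncated series substituted into the stage equations, or
into the integrated differential equation, gains one power of `h` (`isBigO_stage_sub_bseries`,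
`isBigO_solution_sub_bseries`). Plane trees are used because a Taylor term of degree `n`, expanded
multilinearly, is a sum over ordered `n`-tuples of subtrees. With `1 / n!` kept inside the
elementary differential, no symmetry factors appear.

For necessity, a finite set of trees closed under passing to children gives a polynomial system with
one coordinate per tree. There the exact solution has coordinates `h ^ ρ(t) / γ(t)` and the stages
`h ^ ρ(t) * θ(t)`, without remainder, so each tree's condition can be read off its own coordinate
(`isStage_treeSystem`, `hasDerivAt_treeSystem_solution`). -/

theorem iteratedDeriv_comp_line {f : E → F} (hf : ContDiff ℝ ∞ f) (x u : E) (n : ℕ) :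
    iteratedDeriv n (fun s : ℝ => f (x + s • u)) =
      fun s => iteratedFDeriv ℝ n f (x + s • u) (fun _ => u) := by
  induction n with
  | zero => ext s; simp
  | succ n ih =>
    rw [iteratedDeriv_succ, ih]
    funext s
    have hd : DifferentiableAt ℝ (iteratedFDeriv ℝ n f) (x + s • u) :=
      (hf.differentiable_iteratedFDeriv (m := n) (by exact_mod_cast ENat.natCast_lt_top n)) _
    have hl : HasDerivAt (fun s : ℝ => x + s • u) u s := by
      simpa using ((hasDerivAt_id s).smul_const u).const_add x
    have h1 := hd.hasFDerivAt.comp_hasDerivAt s hl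
    have h2 := ((ContinuousMultilinearMap.apply ℝ (fun _ : Fin n => E) F
      (fun _ => u)).hasFDerivAt).comp_hasDerivAt s h1
    rw [iteratedFDeriv_succ_apply_left]
    exact h2.deriv

theorem taylor_isBigO {f : E → F} (hf : ContDiff ℝ ∞ f) (x : E) (n : ℕ) :
    (fun u => f (x + u) - ∑ k ∈ Finset.range (n + 1),
        ((k.factorial : ℝ)⁻¹ • iteratedFDeriv ℝ k f x) (fun _ => u))
      =O[𝓝 0] fun u => ‖u‖ ^ (n + 1) := by
  have hcont : Continuous (iteratedFDeriv ℝ (n + 1) f) :=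
    hf.continuous_iteratedFDeriv (by exact_mod_cast le_top)
  obtain ⟨ε, hε, hb⟩ := Metric.continuousAt_iff.1 (hcont.continuousAt (x := x)) 1 one_pos
  refine IsBigO.of_bound ((‖iteratedFDeriv ℝ (n + 1) f x‖ + 1) / n.factorial) ?_
  filter_upwards [Metric.ball_mem_nhds (0 : E) hε] with u hu
  have hg : ContDiff ℝ ∞ (fun s : ℝ => f (x + s • u)) := by fun_prop
  have heq : ∀ k : ℕ, ∀ s ∈ Set.Icc (0 : ℝ) 1,
      iteratedDerivWithin k (fun s : ℝ => f (x + s • u)) (Set.Icc 0 1) s =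
        iteratedFDeriv ℝ k f (x + s • u) (fun _ => u) := fun k s hs => by
    rw [iteratedDerivWithin_eq_iteratedDeriv (uniqueDiffOn_Icc zero_lt_one)
      (hg.contDiffAt.of_le (by exact_mod_cast le_top)) hs, iteratedDeriv_comp_line hf]
  have key := taylor_mean_remainder_bound (f := fun s : ℝ => f (x + s • u)) (n := n)
    (a := 0) (b := 1) (x := 1) (C := (‖iteratedFDeriv ℝ (n + 1) f x‖ + 1) * ‖u‖ ^ (n + 1))
    zero_le_one (hg.contDiffOn.of_le (by exact_mod_cast le_top)) (by simp) (fun s hs => by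
      rw [heq _ s hs]
      refine (ContinuousMultilinearMap.le_opNorm _ _).trans ?_
      simp only [Finset.prod_const, Finset.card_univ, Fintype.card_fin]
      gcongr
      have : dist (x + s • u) x < ε := by
        have hu' : ‖u‖ < ε := by simpa using hu
        rw [dist_eq_norm, add_sub_cancel_left, norm_smul, Real.norm_of_nonneg hs.1]
        nlinarith [hs.1, hs.2, norm_nonneg u]
      have h1 := (hb this).le
      rw [dist_eq_norm] at h1
      linarith [norm_le_norm_add_norm_sub' (iteratedFDeriv ℝ (n + 1) f (x + s • u))
        (iteratedFDeriv ℝ (n + 1) f x)])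
  rw [taylor_within_apply] at key
  have hsum : ∑ k ∈ Finset.range (n + 1), ((k.factorial : ℝ)⁻¹ * (1 - 0) ^ k) •
      iteratedDerivWithin k (fun s : ℝ => f (x + s • u)) (Set.Icc 0 1) 0 =
      ∑ k ∈ Finset.range (n + 1),
        ((k.factorial : ℝ)⁻¹ • iteratedFDeriv ℝ k f x) (fun _ => u) := by
    refine Finset.sum_congr rfl fun k _ => ?_
    rw [heq k 0 (by simp)]
    simp
  rw [hsum] at key
  simp only [one_smul, sub_zero, one_pow, mul_one] at key
  rw [norm_pow, norm_norm]
  exact key.trans (le_of_eq (by ring))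

end Taylor

/-! ### Finite families of plane trees -/

section Trees

variable {N : ℕ}

theorem PlaneTree.one_le_order (t : PlaneTree N) : 1 ≤ t.order := by
  cases t; simp [PlaneTree.order]

/-- The tree with a given root colour and a given list of subtrees. -/
def nodeEmbedding (N : ℕ) : (Fin N × Σ n : ℕ, Fin n → PlaneTree N) ↪ PlaneTree N where
  toFun x := .node x.1 x.2.1 x.2.2
  inj' := by
    rintro ⟨m, n, ch⟩ ⟨m', n', ch'⟩ h
    cases h
    rfl

/-- Finite sets of trees of bounded height and branching. -/
def trees (N : ℕ) : ℕ → Finset (PlaneTree N)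
  | 0 => ∅
  | r + 1 => ((Finset.univ : Finset (Fin N)) ×ˢ
      (Finset.range (r + 2)).sigma fun n => Fintype.piFinset fun _ : Fin n => trees N r).map
        (nodeEmbedding N)

theorem sum_trees_succ {A : Type*} [AddCommMonoid A] (r : ℕ) (g : PlaneTree N → A) :
    ∑ t ∈ trees N (r + 1), g t = ∑ m : Fin N, ∑ n ∈ Finset.range (r + 2),
      ∑ ch ∈ Fintype.piFinset fun _ : Fin n => trees N r, g (.node m n ch) := by
  rw [trees, Finset.sum_map, Finset.sum_product]
  refine Finset.sum_congr rfl fun m _ => ?_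
  rw [Finset.sum_sigma]
  rfl

variable {E : Type*} [NormedAddCommGroup E] [NormedSpace ℝ E]

/-- The elementary differential of a tree, with respect to the derivatives `D m n`. -/
noncomputable def PlaneTree.elemDiff (D : Fin N → (n : ℕ) → E [×n]→L[ℝ] E) : PlaneTree N → E
  | .node m n ch => D m n fun ℓ => (ch ℓ).elemDiff D

variable {X : Type*} {l : Filter X} {h : X → ℝ}

theorem isBigO_pow_of_le (hh : Tendsto h l (𝓝 0)) {m n : ℕ} (hmn : m ≤ n) :
    (fun x => h x ^ n) =O[l] fun x => h x ^ m := by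
  refine IsBigO.of_bound 1 ?_
  filter_upwards [(hh.norm).eventually_le_const (by simp : ‖(0 : ℝ)‖ < 1)] with x hx
  rw [one_mul, norm_pow, norm_pow]
  exact pow_le_pow_of_le_one (norm_nonneg _) hx hmn

theorem isBigO_bseries (hh : Tendsto h l (𝓝 0)) (T : Finset (PlaneTree N))
    (a : PlaneTree N → ℝ) (F : PlaneTree N → E) :
    (fun x => ∑ t ∈ T, (h x ^ t.order * a t) • F t) =O[l] h := by
  refine IsBigO.fun_sum fun t _ => ?_
  have h1 : (fun x => h x ^ t.order) =O[l] h := by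
    simpa using isBigO_pow_of_le hh t.one_le_order
  have h2 : (fun x => (h x ^ t.order) • (a t • F t)) =O[l] fun x => h x • (1 : ℝ) :=
    h1.smul (isBigO_const_const _ one_ne_zero _)
  simpa [smul_smul] using h2

/-- Each ordered choice `ch` of subtrees occurs exactly once, which is why plane trees need no
combinatorial weights. -/
theorem bseries_multilinear {n : ℕ} (D : E [×n]→L[ℝ] E) (T : Finset (PlaneTree N))
    (a : PlaneTree N → ℝ) (F : PlaneTree N → E) (h : ℝ) :
    D (fun _ => ∑ t ∈ T, (h ^ t.order * a t) • F t) =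
      ∑ ch ∈ Fintype.piFinset fun _ : Fin n => T,
        (h ^ (∑ ℓ, (ch ℓ).order) * ∏ ℓ, a (ch ℓ)) • D (fun ℓ => F (ch ℓ)) := by
  rw [ContinuousMultilinearMap.map_sum_finset]
  refine Finset.sum_congr rfl fun ch _ => ?_
  rw [ContinuousMultilinearMap.map_smul_univ, Finset.prod_mul_distrib, Finset.prod_pow_eq_pow_sum]

/-- A multilinear map is Lipschitz on the unit ball, where both arguments eventually lie. -/
theorem isBigO_multilinear_sub {n : ℕ} (D : E [×n]→L[ℝ] E) {u v : X → E} {g : X → ℝ}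
    (hu : Tendsto u l (𝓝 0)) (hv : Tendsto v l (𝓝 0)) (huv : (fun x => u x - v x) =O[l] g) :
    (fun x => D (fun _ => u x) - D (fun _ => v x)) =O[l] g := by
  refine IsBigO.trans (IsBigO.of_bound (‖D‖ * n) ?_) huv
  filter_upwards [hu.norm.eventually_le_const (by simp : ‖(0 : E)‖ < 1),
    hv.norm.eventually_le_const (by simp : ‖(0 : E)‖ < 1)] with x hx hx'
  refine (D.norm_image_sub_le _ _).trans ?_
  have h1 : max ‖fun _ : Fin n => u x‖ ‖fun _ : Fin n => v x‖ ≤ 1 :=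
    max_le ((pi_norm_le_iff_of_nonneg zero_le_one).2 fun _ => hx)
      ((pi_norm_le_iff_of_nonneg zero_le_one).2 fun _ => hx')
  have h2 : ‖(fun _ : Fin n => u x) - fun _ : Fin n => v x‖ ≤ ‖u x - v x‖ :=
    (pi_norm_le_iff_of_nonneg (norm_nonneg _)).2 fun _ => le_rfl
  have h3 := pow_le_one₀ (n := Fintype.card (Fin n) - 1) (by positivity) h1
  calc _ ≤ ‖D‖ * (Fintype.card (Fin n)) * 1 * ‖u x - v x‖ := by gcongr
    _ = _ := by simp

/-- Substituting a truncated B-series into a smooth function. -/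
theorem isBigO_comp_bseries {φ : E → E} (hφ : ContDiff ℝ ∞ φ) (y₀ : E)
    (hh : Tendsto h l (𝓝 0)) (T : Finset (PlaneTree N)) (a : PlaneTree N → ℝ)
    (F : PlaneTree N → E) {r : ℕ} {u : X → E}
    (hu : (fun x => u x - ∑ t ∈ T, (h x ^ t.order * a t) • F t) =O[l] fun x => h x ^ (r + 1)) :
    (fun x => φ (y₀ + u x) - ∑ n ∈ Finset.range (r + 2),
      ∑ ch ∈ Fintype.piFinset fun _ : Fin n => T,
        (h x ^ (∑ ℓ, (ch ℓ).order) * ∏ ℓ, a (ch ℓ)) •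
          ((n.factorial : ℝ)⁻¹ • iteratedFDeriv ℝ n φ y₀) (fun ℓ => F (ch ℓ)))
      =O[l] fun x => h x ^ (r + 1) := by
  have hB := isBigO_bseries hh T a F
  have huO : u =O[l] h := by
    have h1 : (fun x => h x ^ (r + 1)) =O[l] h := by
      simpa using isBigO_pow_of_le hh (Nat.le_add_left 1 r)
    simpa using (hu.trans h1).add hB
  have hu0 := huO.trans_tendsto hh
  have hB0 := hB.trans_tendsto hh
  -- Degree `r` would already give this error. Degree `r + 1` keeps the linear term in the range for
  -- every `r`, and `bseries_succ` places the Jacobian term there.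
  have h1 := ((taylor_isBigO hφ y₀ (r + 1)).comp_tendsto hu0).trans
    ((huO.norm_left.pow (r + 2)).trans (isBigO_pow_of_le hh (Nat.le_succ (r + 1))))
  have h2 := IsBigO.fun_sum (s := Finset.range (r + 2)) fun n _ => isBigO_multilinear_sub
    ((n.factorial : ℝ)⁻¹ • iteratedFDeriv ℝ n φ y₀) hu0 hB0 hu
  refine (h1.add h2).congr_left fun x => ?_
  simp only [bseries_multilinear, Function.comp, Finset.sum_sub_distrib]
  abel

end Trees

/-! ### The stages -/

section Stages

variable {N : ℕ} {s : Fin N → ℕ}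

/-- The Taylor coefficients of the component functions. -/
noncomputable def taylorCoeff {E : Type*} [NormedAddCommGroup E] [NormedSpace ℝ E]
    (f : Fin N → E → E) (y₀ : E) (m : Fin N) (n : ℕ) : E [×n]→L[ℝ] E :=
  (n.factorial : ℝ)⁻¹ • iteratedFDeriv ℝ n (f m) y₀

/-- The three cases of the recursion merge into the form produced by the stage equation: the
function value contributes an `α`-product for every `n`, while the Jacobian term is linear and
contributes `γ` only for `n = 1`, turning `α` into `β`. -/
theorem Method.planeTheta_node (M : Method N s) (c : Fin N) (n : ℕ) (ch : Fin n → PlaneTree N)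
    (q : Fin N) (i : Fin (s q)) :
    M.planeTheta (.node c n ch) q i = if c = q then
      ∏ ℓ, ∑ m, ∑ j, M.α q m i j * M.planeTheta (ch ℓ) m j +
        (if n = 1 then ∑ ℓ, ∑ m, ∑ j, M.γ q m i j * M.planeTheta (ch ℓ) m j else 0)
      else 0 := by
  by_cases hc : c = q
  · match n, ch with
    | 0, ch => simp [Method.planeTheta, hc]
    | 1, ch =>
      simp [Method.planeTheta, hc, Method.β, Matrix.add_mulVec, Matrix.mulVec, dotProduct,
        Finset.sum_add_distrib]
    | n + 2, ch =>
      simp [Method.planeTheta, hc, Matrix.mulVec, dotProduct, Finset.prod_apply,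
        Finset.sum_apply]
  · match n, ch with
    | 0, ch => simp [Method.planeTheta, hc]
    | 1, ch => simp [Method.planeTheta, hc]
    | n + 2, ch => simp [Method.planeTheta, hc]

variable {d : ℕ} {X : Type*} {l : Filter X} {h : X → ℝ}
  {k : X → (q : Fin N) → Fin (s q) → EuclideanSpace ℝ (Fin d)}

theorem isBigO_smul_left {E : Type*} [NormedAddCommGroup E] [NormedSpace ℝ E] {f : X → E}
    {g : X → ℝ} (hf : f =O[l] g) (c : ℝ) : (fun x => c • f x) =O[l] g :=
  hf.const_smul_left c

theorem isBigO_bseries_linearCombination {E : Type*} [NormedAddCommGroup E] [NormedSpace ℝ E]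
    {k : X → (q : Fin N) → Fin (s q) → E} {T : Finset (PlaneTree N)}
    {θ : PlaneTree N → (q : Fin N) → Fin (s q) → ℝ} {F : PlaneTree N → E} {g : X → ℝ}
    (hk : ∀ m j, (fun x => k x m j - ∑ t ∈ T, (h x ^ t.order * θ t m j) • F t) =O[l] g)
    (A : (m : Fin N) → Fin (s m) → ℝ) :
    (fun x => ∑ m, ∑ j, A m j • k x m j -
      ∑ t ∈ T, (h x ^ t.order * ∑ m, ∑ j, A m j * θ t m j) • F t) =O[l] g := by
  have h1 : (fun x => ∑ m, ∑ j, A m j •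
      (k x m j - ∑ t ∈ T, (h x ^ t.order * θ t m j) • F t)) =O[l] g :=
    IsBigO.fun_sum fun m _ => IsBigO.fun_sum fun j _ => isBigO_smul_left (hk m j) _
  refine h1.congr_left fun x => ?_
  simp only [smul_sub, Finset.sum_sub_distrib, Finset.smul_sum, smul_smul, Finset.mul_sum,
    Finset.sum_smul]
  congr 1
  rw [Finset.sum_comm (s := T)]
  refine Finset.sum_congr rfl fun m _ => ?_
  rw [Finset.sum_comm (s := T)]
  refine Finset.sum_congr rfl fun j _ => Finset.sum_congr rfl fun t _ => ?_
  congr 1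
  ring

/-- All solutions of the stage equations are of the size of the step. -/
theorem Method.isBigO_stage (M : Method N s)
    {f : Fin N → EuclideanSpace ℝ (Fin d) → EuclideanSpace ℝ (Fin d)}
    (hf : ∀ m, ContDiff ℝ ∞ (f m)) {y₀ : EuclideanSpace ℝ (Fin d)} (hh : Tendsto h l (𝓝 0))
    (hk : ∀ᶠ x in l, M.IsStage f y₀ (h x) (k x)) (q : Fin N) (i : Fin (s q)) :
    (fun x => k x q i) =O[l] h := by
  obtain ⟨n, hn⟩ := i
  induction n using Nat.strong_induction_on generalizing q with
  | _ n ih =>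
  -- The diagonal entries of the `γ q m` couple the stages of equal index across all colours, so
  -- these must be estimated jointly. Colours with too few stages are padded by zero.
  set κ : X → Fin N → EuclideanSpace ℝ (Fin d) := fun x q =>
    if hq : n < s q then k x q ⟨n, hq⟩ else 0 with hκ
  have hone : (fun _ => (1 : ℝ)) =O[l] fun x => 1 + ‖κ x‖ :=
    IsBigO.of_bound 1 (Eventually.of_forall fun x => by
      rw [one_mul, norm_one, Real.norm_of_nonneg (by positivity)]
      linarith [norm_nonneg (κ x)])
  have hκone : ∀ m, (fun x => κ x m) =O[l] fun x => 1 + ‖κ x‖ := fun m =>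
    IsBigO.of_bound 1 (Eventually.of_forall fun x => by
      rw [one_mul, Real.norm_of_nonneg (by positivity)]
      linarith [norm_le_pi_norm (κ x) m])
  have hstep : ∀ q, (fun x => κ x q) =O[l] fun x => h x * (1 + ‖κ x‖) := by
    intro q
    by_cases hq : n < s q
    swap
    · simp only [hκ, dif_neg hq]
      exact isBigO_zero _ _
    have hα : (fun x => ∑ m, ∑ j, M.α q m ⟨n, hq⟩ j • k x m j) =O[l] h := by
      refine IsBigO.fun_sum fun m _ => IsBigO.fun_sum fun j _ => ?_
      rcases le_or_gt n j with hj | hj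
      · simp only [M.α_strictLower q m ⟨n, hq⟩ j hj, zero_smul]
        exact isBigO_zero _ _
      · exact isBigO_smul_left (ih j hj m j.2) _
    have hγ : (fun x => ∑ m, ∑ j, M.γ q m ⟨n, hq⟩ j • k x m j) =O[l] fun x => 1 + ‖κ x‖ := by
      refine IsBigO.fun_sum fun m _ => IsBigO.fun_sum fun j _ => ?_
      rcases lt_trichotomy n j with hj | hj | hj
      · simp only [M.γ_lower q m ⟨n, hq⟩ j hj, zero_smul]
        exact isBigO_zero _ _
      · refine isBigO_smul_left ?_ _
        refine (hκone m).congr_left fun x => ?_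
        subst hj
        simp [hκ]
      · exact isBigO_smul_left (((ih j hj m j.2).trans (hh.isBigO_one ℝ)).trans hone) _
    have hfO : (fun x => f q (y₀ + ∑ m, ∑ j, M.α q m ⟨n, hq⟩ j • k x m j)) =O[l]
        fun x => 1 + ‖κ x‖ := by
      refine IsBigO.trans (Tendsto.isBigO_one ℝ (c := f q (y₀ + 0)) ?_) hone
      exact ((hf q).continuous.tendsto _).comp (tendsto_const_nhds.add (hα.trans_tendsto hh))
    have hJ := (fderiv ℝ (f q) y₀).isBigO_comp (fun x => ∑ m, ∑ j, M.γ q m ⟨n, hq⟩ j • k x m j) l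
    have hsum := (isBigO_refl h l).smul (hfO.add (hJ.trans hγ))
    refine hsum.congr' ?_ EventuallyEq.rfl
    filter_upwards [hk] with x hx
    simp only [hκ, dif_pos hq]
    rw [hx q ⟨n, hq⟩, smul_add]
  obtain ⟨C, hC, hb⟩ := (isBigO_pi.2 hstep).exists_pos
  have hb := hb.bound
  -- From `‖κ‖ ≤ C |h| (1 + ‖κ‖)` and `C |h| ≤ 1 / 2`, half of `‖κ‖` is absorbed on the left, which
  -- gives the constant `2 * C`.
  have hκO : κ =O[l] h := by
    refine IsBigO.of_bound (2 * C) ?_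
    have hsmall : ∀ᶠ x in l, C * ‖h x‖ ≤ 1 / 2 := by
      have : Tendsto (fun x => C * ‖h x‖) l (𝓝 (C * ‖(0 : ℝ)‖)) := hh.norm.const_mul C
      exact this.eventually_le_const (by norm_num)
    filter_upwards [hb, hsmall] with x hx hx'
    rw [norm_mul, Real.norm_of_nonneg (by positivity : 0 ≤ 1 + ‖κ x‖)] at hx
    nlinarith [norm_nonneg (κ x)]
  refine (isBigO_pi.1 hκO q).congr_left fun x => ?_
  simp [hκ, hn]

theorem sum_piFinset_one {A : Type*} [AddCommMonoid A] (T : Finset (PlaneTree N))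
    (g : (Fin 1 → PlaneTree N) → A) :
    ∑ ch ∈ Fintype.piFinset (fun _ : Fin 1 => T), g ch = ∑ t ∈ T, g fun _ => t := by
  refine Finset.sum_bij' (fun ch _ => ch 0) (fun t _ => fun _ => t) ?_ ?_ ?_ ?_ ?_
  · intro ch hch
    exact Fintype.mem_piFinset.1 hch 0
  · intro t ht
    exact Fintype.mem_piFinset.2 fun _ => ht
  · intro ch _
    funext i
    rw [Subsingleton.elim i 0]
  · intro t _
    rfl
  · intro ch _
    congr 1
    funext i
    rw [Subsingleton.elim i 0]

/-- The B-series of the stages is compatible with the stage equations. -/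
theorem Method.bseries_succ (M : Method N s)
    (f : Fin N → EuclideanSpace ℝ (Fin d) → EuclideanSpace ℝ (Fin d))
    (y₀ : EuclideanSpace ℝ (Fin d)) (h : ℝ) (r : ℕ) (q : Fin N) (i : Fin (s q)) :
    ∑ t ∈ trees N (r + 1), (h ^ t.order * M.planeTheta t q i) • t.elemDiff (taylorCoeff f y₀) =
      h • (∑ n ∈ Finset.range (r + 2), ∑ ch ∈ Fintype.piFinset fun _ : Fin n => trees N r,
          (h ^ (∑ ℓ, (ch ℓ).order) *
            ∏ ℓ, ∑ m, ∑ j, M.α q m i j * M.planeTheta (ch ℓ) m j) •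
          taylorCoeff f y₀ q n (fun ℓ => (ch ℓ).elemDiff (taylorCoeff f y₀))) +
      h • fderiv ℝ (f q) y₀ (∑ t ∈ trees N r,
        (h ^ t.order * ∑ m, ∑ j, M.γ q m i j * M.planeTheta t m j) •
          t.elemDiff (taylorCoeff f y₀)) := by
  rw [sum_trees_succ, Finset.sum_eq_single q]
  rotate_left
  · intro m _ hm
    refine Finset.sum_eq_zero fun n _ => Finset.sum_eq_zero fun ch _ => ?_
    rw [M.planeTheta_node, if_neg hm, mul_zero, zero_smul]
  · simp
  -- The Jacobian term is spread over the index set of the Taylor sum, supported on `n = 1`, so that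
  -- the two sums can be added termwise.
  have hJ : fderiv ℝ (f q) y₀ (∑ t ∈ trees N r,
        (h ^ t.order * ∑ m, ∑ j, M.γ q m i j * M.planeTheta t m j) •
          t.elemDiff (taylorCoeff f y₀)) =
      ∑ n ∈ Finset.range (r + 2), ∑ ch ∈ Fintype.piFinset fun _ : Fin n => trees N r,
        (h ^ (∑ ℓ, (ch ℓ).order) *
          (if n = 1 then ∑ ℓ, ∑ m, ∑ j, M.γ q m i j * M.planeTheta (ch ℓ) m j else 0)) •
        taylorCoeff f y₀ q n (fun ℓ => (ch ℓ).elemDiff (taylorCoeff f y₀)) := by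
    symm
    rw [Finset.sum_eq_single (1 : ℕ)]
    · rw [sum_piFinset_one, map_sum]
      refine Finset.sum_congr rfl fun t _ => ?_
      simp [taylorCoeff, iteratedFDeriv_one_apply]
    · intro n _ hn
      simp [hn]
    · simp
  rw [hJ, ← smul_add, ← Finset.sum_add_distrib, Finset.smul_sum]
  refine Finset.sum_congr rfl fun n _ => ?_
  rw [← Finset.sum_add_distrib, Finset.smul_sum]
  refine Finset.sum_congr rfl fun ch _ => ?_
  rw [M.planeTheta_node, if_pos rfl, PlaneTree.order, PlaneTree.elemDiff, ← add_smul, smul_smul]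
  congr 1
  ring

/-- The right side of the stage equation carries a factor `h`, so inserting an expansion with error
`h ^ (r + 1)` yields one with error `h ^ (r + 2)`. The a priori bound `isBigO_stage` starts the
induction with the empty series, so the implicit dependence through `γ` causes no difficulty. -/
theorem Method.isBigO_stage_sub_bseries (M : Method N s)
    {f : Fin N → EuclideanSpace ℝ (Fin d) → EuclideanSpace ℝ (Fin d)}
    (hf : ∀ m, ContDiff ℝ ∞ (f m)) {y₀ : EuclideanSpace ℝ (Fin d)} (hh : Tendsto h l (𝓝 0))
    (hk : ∀ᶠ x in l, M.IsStage f y₀ (h x) (k x)) (r : ℕ) (q : Fin N) (i : Fin (s q)) :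
    (fun x => k x q i - ∑ t ∈ trees N r,
      (h x ^ t.order * M.planeTheta t q i) • t.elemDiff (taylorCoeff f y₀))
      =O[l] fun x => h x ^ (r + 1) := by
  induction r generalizing q with
  | zero => simpa [trees] using M.isBigO_stage hf hh hk q i
  | succ r ih =>
    have h1 := isBigO_comp_bseries (hf q) y₀ hh _ _ _
      (isBigO_bseries_linearCombination (fun m j => ih m j) (fun m => M.α q m i))
    have h2 := ((fderiv ℝ (f q) y₀).isBigO_comp _ l).trans
      (isBigO_bseries_linearCombination (fun m j => ih m j) (fun m => M.γ q m i))
    have h3 := (isBigO_refl h l).smul (h1.add h2)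
    refine h3.congr' ?_ (Eventually.of_forall fun x => by simp only [smul_eq_mul]; ring)
    filter_upwards [hk] with x hx
    rw [M.bseries_succ, map_sub, hx q i]
    simp only [taylorCoeff, smul_add, smul_sub]
    abel

/-- For small steps the stage equations have a solution. -/
theorem Method.eventually_exists_isStage (M : Method N s)
    {f : Fin N → EuclideanSpace ℝ (Fin d) → EuclideanSpace ℝ (Fin d)}
    (hf : ∀ m, ContDiff ℝ ∞ (f m)) (y₀ : EuclideanSpace ℝ (Fin d)) :
    ∀ᶠ h in 𝓝 (0 : ℝ), ∃ k, M.IsStage f y₀ h k := by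
  let V := (q : Fin N) → Fin (s q) → EuclideanSpace ℝ (Fin d)
  let Ψ : V → V := fun k q i => f q (y₀ + ∑ m : Fin N, ∑ j : Fin (s m), M.α q m i j • k m j)
      + fderiv ℝ (f q) y₀ (∑ m : Fin N, ∑ j : Fin (s m), M.γ q m i j • k m j)
  have hΨ : ContDiff ℝ 1 Ψ := by
    refine contDiff_pi.2 fun q => contDiff_pi.2 fun i => ?_
    have hlin : ∀ A : (m : Fin N) → Fin (s m) → ℝ,
        ContDiff ℝ 1 fun k : V => ∑ m, ∑ j, A m j • k m j := fun A =>
      ContDiff.sum fun m _ => ContDiff.sum fun j _ =>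
        (((ContinuousLinearMap.proj (R := ℝ) j).comp (ContinuousLinearMap.proj (R := ℝ)
          (φ := fun m => Fin (s m) → EuclideanSpace ℝ (Fin d)) m)).contDiff).const_smul _
    exact (((hf q).of_le (by exact_mod_cast le_top)).comp (contDiff_const.add (hlin _))).add
      ((fderiv ℝ (f q) y₀).contDiff.comp (hlin _))
  -- The derivative of `G` at the origin is surjective, so the range of `G` is a neighbourhood of `G
  -- 0 = 0`. It therefore contains `(h, 0)` for small `h`, and a preimage is a solution of the stage
  -- equations.
  let G : ℝ × V → ℝ × V := fun z => (z.1, z.2 - z.1 • Ψ z.2)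
  have hΨ' : HasStrictFDerivAt (fun z : ℝ × V => Ψ z.2)
      ((fderiv ℝ Ψ 0).comp (ContinuousLinearMap.snd ℝ ℝ V)) (0 : ℝ × V) :=
    HasStrictFDerivAt.comp (0 : ℝ × V) (hΨ.contDiffAt.hasStrictFDerivAt one_ne_zero)
      hasStrictFDerivAt_snd
  have hG := (hasStrictFDerivAt_fst (𝕜 := ℝ) (p := (0 : ℝ × V))).prodMk
    ((hasStrictFDerivAt_snd (𝕜 := ℝ) (p := (0 : ℝ × V))).sub
      ((hasStrictFDerivAt_fst (𝕜 := ℝ) (p := (0 : ℝ × V))).smul hΨ'))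
  have hmap := hG.map_nhds_eq_of_surj (LinearMap.range_eq_top.2 fun z =>
    ⟨(z.1, z.2 + z.1 • Ψ 0), by ext <;> simp⟩)
  have hrange : Set.range G ∈ 𝓝 (0 : ℝ × V) := by
    have : Set.range G ∈ map G (𝓝 0) := by
      rw [mem_map]
      exact Filter.mem_of_superset univ_mem fun z _ => ⟨z, rfl⟩
    have h2 : map G (𝓝 0) = 𝓝 0 := by
      refine hmap.trans ?_
      simp
    rwa [h2] at this
  have hc : Tendsto (fun h : ℝ => ((h, 0) : ℝ × V)) (𝓝 0) (𝓝 0) := by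
    have : Continuous fun h : ℝ => ((h, 0) : ℝ × V) := by fun_prop
    exact this.tendsto 0
  filter_upwards [hc hrange] with h hmem
  obtain ⟨⟨h', k⟩, hk⟩ := hmem
  have h1 : h' = h := congrArg Prod.fst hk
  have h2 : k - h' • Ψ k = 0 := congrArg Prod.snd hk
  subst h1
  refine ⟨k, fun q i => ?_⟩
  rw [← smul_add]
  exact congrFun (congrFun (sub_eq_zero.1 h2) q) i

end Stages

/-! ### The exact solution -/

section Exact

variable {E : Type*} [NormedAddCommGroup E] [NormedSpace ℝ E] {N : ℕ}

/-- Mean value inequality on `[0, x]`: integration gains one power. The statement is one-sided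
because the solution is only given to the right of the initial time. -/
theorem isBigO_of_hasDerivWithinAt {W R : ℝ → E} {δ : ℝ} (hδ : 0 < δ) (hW : W 0 = 0)
    (hd : ∀ x ∈ Set.Icc 0 δ, HasDerivWithinAt W (R x) (Set.Icc 0 δ) x) {n : ℕ}
    (hR : R =O[𝓝[≥] 0] fun x => x ^ n) : W =O[𝓝[≥] 0] fun x => x ^ (n + 1) := by
  obtain ⟨C, hC, hb⟩ := hR.exists_nonneg
  obtain ⟨ε, hε, hsub⟩ := mem_nhdsGE_iff_exists_Ico_subset.1 hb.bound
  refine IsBigO.of_bound C ?_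
  filter_upwards [Ico_mem_nhdsGE (lt_min hδ hε)] with x hx
  have hxδ : x < δ := hx.2.trans_le (min_le_left _ _)
  have hxε : x < ε := hx.2.trans_le (min_le_right _ _)
  have := Convex.norm_image_sub_le_of_norm_hasDerivWithin_le (f := W) (f' := R)
    (s := Set.Icc 0 x) (C := C * x ^ n) (x := 0) (y := x)
    (fun z hz => (hd z ⟨hz.1, hz.2.trans hxδ.le⟩).mono (Set.Icc_subset_Icc_right hxδ.le))
    (fun z hz => by
      have h1 : ‖R z‖ ≤ C * ‖z ^ n‖ := hsub ⟨hz.1, hz.2.trans_lt hxε⟩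
      rw [norm_pow, Real.norm_of_nonneg hz.1] at h1
      exact h1.trans (mul_le_mul_of_nonneg_left (pow_le_pow_left₀ hz.1 hz.2 n) hC))
    (convex_Icc 0 x) (Set.left_mem_Icc.2 hx.1) (Set.right_mem_Icc.2 hx.1)
  rw [hW, sub_zero, sub_zero] at this
  rw [norm_pow, pow_succ, ← mul_assoc]
  rwa [Real.norm_of_nonneg hx.1] at this ⊢

/-- Differentiating `h ^ ρ(t)` produces the factor `ρ(t)`, which cancels the same factor in the
density. What remains is the product of the coefficients of the subtrees, as in the substitution of
the shorter series into the Taylor polynomials. -/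
theorem hasDerivAt_bseries_exact (f : Fin N → E → E) (y₀ : E) (r : ℕ) (h : ℝ) :
    HasDerivAt (fun h : ℝ => ∑ t ∈ trees N (r + 1),
        (h ^ t.order * (t.density : ℝ)⁻¹) • t.elemDiff (taylorCoeff f y₀))
      (∑ m, ∑ n ∈ Finset.range (r + 2), ∑ ch ∈ Fintype.piFinset fun _ : Fin n => trees N r,
        (h ^ (∑ ℓ, (ch ℓ).order) * ∏ ℓ, ((ch ℓ).density : ℝ)⁻¹) •
          taylorCoeff f y₀ m n (fun ℓ => (ch ℓ).elemDiff (taylorCoeff f y₀))) h := by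
  rw [← Finset.sum_fn]
  have h1 : HasDerivAt (∑ t ∈ trees N (r + 1), fun h : ℝ =>
        (h ^ t.order * (t.density : ℝ)⁻¹) • t.elemDiff (taylorCoeff f y₀))
      (∑ t ∈ trees N (r + 1), (t.order * h ^ (t.order - 1) * (t.density : ℝ)⁻¹) •
        t.elemDiff (taylorCoeff f y₀)) h :=
    HasDerivAt.sum fun t _ =>
      ((hasDerivAt_pow t.order h).mul_const _).smul_const _
  convert h1 using 1
  rw [sum_trees_succ]
  refine Finset.sum_congr rfl fun m _ => Finset.sum_congr rfl fun n _ =>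
    Finset.sum_congr rfl fun ch _ => ?_
  rw [PlaneTree.elemDiff, PlaneTree.density, PlaneTree.order]
  congr 1
  rw [Nat.add_sub_cancel_left]
  push_cast
  have : (1 + ∑ ℓ, ((ch ℓ).order : ℝ)) ≠ 0 := by positivity
  rw [mul_inv, Finset.prod_inv_distrib]
  field_simp

/-- Picard iteration on remainders: the defect of the derivative is controlled by the previous
expansion and then integrated. The base case is differentiability at `0`. -/
theorem isBigO_solution_sub_bseries {f : Fin N → E → E} (hf : ∀ m, ContDiff ℝ ∞ (f m))
    {δ : ℝ} (hδ : 0 < δ) {y₀ : E} {v : ℝ → E} (hv0 : v 0 = 0)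
    (hv : ∀ t ∈ Set.Icc 0 δ, HasDerivWithinAt v (∑ m, f m (y₀ + v t)) (Set.Icc 0 δ) t) (r : ℕ) :
    (fun h => v h - ∑ t ∈ trees N r,
      (h ^ t.order * (t.density : ℝ)⁻¹) • t.elemDiff (taylorCoeff f y₀))
      =O[𝓝[≥] 0] fun h => h ^ (r + 1) := by
  induction r with
  | zero =>
    have h1 := (hv 0 ⟨le_rfl, hδ.le⟩).isBigO_sub
    rw [nhdsWithin_Icc_eq_nhdsGE hδ] at h1
    simpa [trees, hv0, Function.comp_def] using h1
  | succ r ih =>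
    refine isBigO_of_hasDerivWithinAt hδ ?_ (fun x hx =>
      (hv x hx).sub (hasDerivAt_bseries_exact f y₀ r x).hasDerivWithinAt) ?_
    · rw [Pi.sub_apply, hv0, zero_sub, neg_eq_zero]
      refine Finset.sum_eq_zero fun t _ => ?_
      rw [zero_pow (by have := t.one_le_order; omega), zero_mul, zero_smul]
    · have hh : Tendsto (fun h : ℝ => h) (𝓝[≥] 0) (𝓝 0) := nhdsWithin_le_nhds
      have h1 := IsBigO.fun_sum (s := Finset.univ) fun m _ =>
        isBigO_comp_bseries (hf m) y₀ hh _ _ _ ih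
      refine h1.congr_left fun x => ?_
      rw [← Finset.sum_sub_distrib]
      rfl

end Exact

/-! ### The order conditions are sufficient -/

section Sufficient

variable {N : ℕ} {s : Fin N → ℕ}

theorem Method.hasOrder_of_planeTheta (M : Method N s) {p : ℕ}
    (hM : ∀ t : PlaneTree N, t.order ≤ p →
      ∑ m, ∑ i, M.b m i * M.planeTheta t m i = (t.density : ℝ)⁻¹) : M.HasOrder p := by
  intro d f hf t₀ tF y ht hy
  let V := (q : Fin N) → Fin (s q) → EuclideanSpace ℝ (Fin d)
  -- The filter runs over all pairs of a step size and a stage solution. The resulting constant is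
  -- therefore uniform over all solutions, and their uniqueness is never needed.
  let l : Filter (ℝ × V) := comap Prod.fst (𝓝[>] 0) ⊓ 𝓟 {x | M.IsStage f (y t₀) x.1 x.2}
  have hl : Tendsto Prod.fst l (𝓝[>] 0) := tendsto_comap.mono_left inf_le_left
  have hl0 : Tendsto Prod.fst l (𝓝 0) := hl.mono_right nhdsWithin_le_nhds
  have hl1 : Tendsto Prod.fst l (𝓝[≥] 0) :=
    hl.mono_right (nhdsWithin_mono _ Set.Ioi_subset_Ici_self)
  have hk : ∀ᶠ x in l, M.IsStage f (y t₀) x.1 x.2 :=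
    mem_inf_of_right (mem_principal_self _)
  have hnum := isBigO_bseries_linearCombination
    (fun q i => M.isBigO_stage_sub_bseries (k := Prod.snd) hf hl0 hk p q i) M.b
  have hv : ∀ t ∈ Set.Icc 0 (tF - t₀), HasDerivWithinAt (fun h => y (t₀ + h) - y t₀)
      (∑ m, f m (y t₀ + (y (t₀ + t) - y t₀))) (Set.Icc 0 (tF - t₀)) t := by
    intro t htm
    have h1 := HasDerivWithinAt.scomp t
      (hy (t₀ + t) ⟨by linarith [htm.1], by linarith [htm.2]⟩) ((hasDerivAt_id t).const_add t₀).hasDerivWithinAt (s := Set.Icc 0 (tF - t₀))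
      (fun x hx => ⟨by simpa using hx.1, by simpa using by linarith [hx.2]⟩)
    simpa [Function.comp_def] using h1.sub_const (y t₀)
  have hex := (isBigO_solution_sub_bseries hf (sub_pos.2 ht)
    (v := fun h => y (t₀ + h) - y t₀) (by simp) hv p).comp_tendsto hl1
  -- Trees of order at most `p` cancel by hypothesis. The larger trees that `trees N p` also
  -- contains are absorbed into the error.
  have hdiff : (fun x : ℝ × V => ∑ t ∈ trees N p,
      (x.1 ^ t.order * ((t.density : ℝ)⁻¹ - ∑ m, ∑ i, M.b m i * M.planeTheta t m i)) •
        t.elemDiff (taylorCoeff f (y t₀))) =O[l] fun x => x.1 ^ (p + 1) := by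
    refine IsBigO.fun_sum fun t _ => ?_
    rcases le_or_gt t.order p with hle | hgt
    · simp only [hM t hle, sub_self, mul_zero, zero_smul]
      exact isBigO_zero _ _
    · simp only [mul_comm (_ ^ _), mul_smul]
      refine isBigO_smul_left ?_ _
      have h1 : (fun x : ℝ × V => x.1 ^ t.order • t.elemDiff (taylorCoeff f (y t₀))) =O[l]
          fun x => x.1 ^ (p + 1) • (1 : ℝ) :=
        (isBigO_pow_of_le hl0 hgt).smul (isBigO_const_const _ one_ne_zero _)
      simpa using h1
  obtain ⟨C, hC⟩ := ((hex.sub hnum).add hdiff).bound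
  refine ⟨C, ?_⟩
  have hstage : ∀ᶠ h in 𝓝[>] (0 : ℝ), ∃ k, M.IsStage f (y t₀) h k :=
    nhdsWithin_le_nhds (M.eventually_exists_isStage hf (y t₀))
  rw [eventually_inf_principal, eventually_comap] at hC
  filter_upwards [hstage, hC, self_mem_nhdsWithin] with h ⟨k, hk⟩ hh hpos
  refine ⟨⟨_, k, hk, rfl⟩, ?_⟩
  rintro y₁ ⟨k, hk, rfl⟩
  have h1 := hh (h, k) rfl hk
  simp only [Function.comp, norm_pow, Real.norm_of_nonneg (le_of_lt hpos)] at h1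
  refine le_trans (le_of_eq ?_) h1
  congr 1
  simp only [mul_sub, sub_smul, Finset.sum_sub_distrib]
  abel

end Sufficient

/-! ### The order conditions are necessary -/

section Necessary

variable {N : ℕ} {s : Fin N → ℕ}

/-- Finiteness makes the test system finite-dimensional; closure under children makes its right side
expressible in its own coordinates. -/
theorem PlaneTree.exists_finite_closed (t : PlaneTree N) :
    ∃ S : Set (PlaneTree N), S.Finite ∧ t ∈ S ∧
      ∀ m n ch, PlaneTree.node m n ch ∈ S → ∀ ℓ, ch ℓ ∈ S := by
  induction t with
  | node m n ch ih =>
    choose S hfin hmem hcl using ih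
    refine ⟨insert (.node m n ch) (⋃ ℓ, S ℓ), (Set.finite_iUnion hfin).insert _,
      Set.mem_insert _ _, ?_⟩
    intro m' n' ch' h ℓ
    rcases h with h | h
    · cases h
      exact Or.inr (Set.mem_iUnion.2 ⟨ℓ, hmem ℓ⟩)
    · obtain ⟨i, hi⟩ := Set.mem_iUnion.1 h
      exact Or.inr (Set.mem_iUnion.2 ⟨i, hcl i _ _ _ hi ℓ⟩)

/-- The component of colour `q` at the vertex `u` of the system associated with a set of trees,
for values `z` at all trees. -/
def PlaneTree.field (z : PlaneTree N → ℝ) (q : Fin N) : PlaneTree N → ℝ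
  | .node m _ ch => if m = q then ∏ ℓ, z (ch ℓ) else 0

variable {d : ℕ} {S : Set (PlaneTree N)} (e : Fin d ≃ S)

open Classical in
/-- The coordinate belonging to a tree. -/
noncomputable def coord (u : PlaneTree N) : EuclideanSpace ℝ (Fin d) →L[ℝ] ℝ :=
  if hu : u ∈ S then EuclideanSpace.proj (e.symm ⟨u, hu⟩) else 0

/-- The system whose solution has the coordinates `t ^ ρ(u) / γ(u)`. -/
noncomputable def treeSystem (q : Fin N) (y : EuclideanSpace ℝ (Fin d)) :
    EuclideanSpace ℝ (Fin d) :=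
  WithLp.toLp 2 fun i => PlaneTree.field (fun u => coord e u y) q (e i)

theorem coord_apply (z : PlaneTree N → ℝ) {u : PlaneTree N} (hu : u ∈ S) :
    coord e u (WithLp.toLp 2 fun i => z (e i)) = z u := by
  simp [coord, hu]

/-- A product of two or more coordinates has zero derivative at the origin, since a vanishing factor
always survives. Hence the Jacobian sees only vertices with a single child, just as `γ` enters `θ`.
-/
theorem hasFDerivAt_field_zero (q : Fin N) (m : Fin N) (n : ℕ) (ch : Fin n → PlaneTree N) :
    HasFDerivAt (fun y => PlaneTree.field (fun u => coord e u y) q (.node m n ch))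
      (if m = q then if n = 1 then ∑ ℓ, coord e (ch ℓ) else 0 else 0) 0 := by
  simp only [PlaneTree.field]
  split_ifs with hm hn
  · subst hn
    simpa using (coord e (ch 0)).hasFDerivAt
  · have h1 := HasFDerivAt.finsetProd (u := (Finset.univ : Finset (Fin n)))
      (g := fun ℓ y => coord e (ch ℓ) y) (x := 0) fun ℓ _ => (coord e (ch ℓ)).hasFDerivAt
    refine h1.congr_fderiv (Finset.sum_eq_zero fun ℓ _ => ?_)
    have hcard : ((Finset.univ : Finset (Fin n)).erase ℓ).Nonempty := by
      rw [← Finset.card_pos, Finset.card_erase_of_mem (Finset.mem_univ _), Finset.card_univ,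
        Fintype.card_fin]
      have := ℓ.2
      omega
    obtain ⟨j, hj⟩ := hcard
    rw [Finset.prod_eq_zero hj (by simp), zero_smul]
  · exact hasFDerivAt_const _ _

theorem contDiff_treeSystem (q : Fin N) : ContDiff ℝ ∞ (treeSystem e q) := by
  rw [contDiff_euclidean]
  intro i
  simp only [treeSystem]
  cases (e i : PlaneTree N) with
  | node m n ch =>
    simp only [PlaneTree.field]
    split_ifs
    · exact contDiff_prod fun ℓ _ => (coord e (ch ℓ)).contDiff
    · exact contDiff_const

theorem fderiv_treeSystem_zero (q : Fin N) (w : EuclideanSpace ℝ (Fin d)) (i : Fin d)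
    {m : Fin N} {n : ℕ} {ch : Fin n → PlaneTree N} (hi : (e i : PlaneTree N) = .node m n ch) :
    fderiv ℝ (treeSystem e q) 0 w i =
      if m = q then if n = 1 then ∑ ℓ, coord e (ch ℓ) w else 0 else 0 := by
  have h1 := ((contDiff_treeSystem e q).differentiable (by simp) 0).hasFDerivAt
  have h2 := (EuclideanSpace.proj i : EuclideanSpace ℝ (Fin d) →L[ℝ] ℝ).hasFDerivAt.comp 0 h1
  have h3 := hasFDerivAt_field_zero e q m n ch
  have h4 : (fun y => PlaneTree.field (fun u => coord e u y) q (.node m n ch)) =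
      (EuclideanSpace.proj i : EuclideanSpace ℝ (Fin d) →L[ℝ] ℝ) ∘ treeSystem e q := by
    funext y
    simp [treeSystem, hi]
  rw [h4] at h3
  have h5 := congrArg (fun L => L w) (h2.unique h3)
  exact h5.trans (by split_ifs <;> simp)

/-- In the coordinate of a tree the stage equation is the recursion `planeTheta_node` multiplied by
a power of `h`, so the B-series is exact for every `h`. -/
theorem Method.isStage_treeSystem (M : Method N s)
    (hS : ∀ m n ch, PlaneTree.node m n ch ∈ S → ∀ ℓ, ch ℓ ∈ S) (h : ℝ) :
    M.IsStage (treeSystem e) 0 h fun q i =>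
      WithLp.toLp 2 fun c => h ^ (e c : PlaneTree N).order * M.planeTheta (e c) q i := by
  intro q i
  ext c
  obtain ⟨m, n, ch, hc⟩ : ∃ m n ch, (e c : PlaneTree N) = .node m n ch := by
    cases (e c : PlaneTree N) with
    | node m n ch => exact ⟨m, n, ch, rfl⟩
  have hch : ∀ ℓ, ch ℓ ∈ S := hS m n ch (hc ▸ (e c).2)
  have hcoord : ∀ (A : (m : Fin N) → Fin (s m) → ℝ) (ℓ : Fin n), coord e (ch ℓ)
      (∑ m, ∑ j, A m j • WithLp.toLp 2 fun c =>
        h ^ (e c : PlaneTree N).order * M.planeTheta (e c) m j) =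
      h ^ (ch ℓ).order * ∑ m, ∑ j, A m j * M.planeTheta (ch ℓ) m j := by
    intro A ℓ
    simp only [map_sum, map_smul, smul_eq_mul, Finset.mul_sum]
    refine Finset.sum_congr rfl fun m _ => Finset.sum_congr rfl fun j _ => ?_
    rw [coord_apply e (fun u => h ^ u.order * M.planeTheta u m j) (hch ℓ)]
    ring
  rw [PiLp.add_apply, PiLp.smul_apply, PiLp.smul_apply, fderiv_treeSystem_zero e q _ c hc]
  simp only [treeSystem, hc, PlaneTree.field, zero_add, hcoord, M.planeTheta_node,
    PlaneTree.order, smul_eq_mul]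
  split_ifs with hm hn
  · subst hn
    simp
    ring
  · rw [Finset.prod_mul_distrib, Finset.prod_pow_eq_pow_sum]
    ring
  · simp

/-- Only the component with the root's colour acts on a coordinate, and the recursion of the density
is exactly what the power rule requires. -/
theorem hasDerivAt_treeSystem_solution
    (hS : ∀ m n ch, PlaneTree.node m n ch ∈ S → ∀ ℓ, ch ℓ ∈ S) (t : ℝ) :
    HasDerivAt (fun t : ℝ => (WithLp.toLp 2 fun c =>
        t ^ (e c : PlaneTree N).order * ((e c : PlaneTree N).density : ℝ)⁻¹ :
          EuclideanSpace ℝ (Fin d)))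
      (∑ m, treeSystem e m (WithLp.toLp 2 fun c =>
        t ^ (e c : PlaneTree N).order * ((e c : PlaneTree N).density : ℝ)⁻¹)) t := by
  suffices hpi : HasDerivAt (fun (t : ℝ) (c : Fin d) =>
        t ^ (e c : PlaneTree N).order * ((e c : PlaneTree N).density : ℝ)⁻¹)
      (WithLp.ofLp (∑ m, treeSystem e m (WithLp.toLp 2 fun c =>
        t ^ (e c : PlaneTree N).order * ((e c : PlaneTree N).density : ℝ)⁻¹))) t by
    exact (PiLp.continuousLinearEquiv 2 ℝ
      fun _ : Fin d => ℝ).symm.hasFDerivAt.comp_hasDerivAt t hpi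
  refine hasDerivAt_pi.2 fun c => ?_
  have h1 := (hasDerivAt_pow (e c : PlaneTree N).order t).mul_const
    ((e c : PlaneTree N).density : ℝ)⁻¹
  refine h1.congr_deriv (Eq.symm ?_)
  obtain ⟨m, n, ch, hc⟩ : ∃ m n ch, (e c : PlaneTree N) = .node m n ch := by
    cases (e c : PlaneTree N) with
    | node m n ch => exact ⟨m, n, ch, rfl⟩
  have hch : ∀ ℓ, ch ℓ ∈ S := hS m n ch (hc ▸ (e c).2)
  have hcoord : ∀ ℓ, coord e (ch ℓ) (WithLp.toLp 2 fun c =>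
        t ^ (e c : PlaneTree N).order * ((e c : PlaneTree N).density : ℝ)⁻¹) =
      t ^ (ch ℓ).order * ((ch ℓ).density : ℝ)⁻¹ := fun ℓ =>
    coord_apply e (fun u => t ^ u.order * (u.density : ℝ)⁻¹) (hch ℓ)
  simp only [WithLp.ofLp_sum, Finset.sum_apply, treeSystem, hc, PlaneTree.field, hcoord,
    Finset.sum_ite_eq, Finset.mem_univ, if_true]
  rw [PlaneTree.density, PlaneTree.order, Nat.add_sub_cancel_left, Finset.prod_mul_distrib,
    Finset.prod_pow_eq_pow_sum]
  push_cast
  have : (1 + ∑ ℓ, ((ch ℓ).order : ℝ)) ≠ 0 := by positivity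
  rw [mul_inv, Finset.prod_inv_distrib]
  field_simp

theorem Method.HasOrder.planeTheta_eq {M : Method N s} {p : ℕ} (hM : M.HasOrder p)
    (t : PlaneTree N) (ht : t.order ≤ p) :
    ∑ m, ∑ i, M.b m i * M.planeTheta t m i = (t.density : ℝ)⁻¹ := by
  obtain ⟨S, hfin, htS, hS⟩ := t.exists_finite_closed
  have := hfin.fintype
  let e : Fin (Fintype.card S) ≃ S := (Fintype.equivFin S).symm
  obtain ⟨C, hC⟩ := hM _ (treeSystem e) (contDiff_treeSystem e) 0 1 _ one_pos
    fun x _ => (hasDerivAt_treeSystem_solution e hS x).hasDerivWithinAt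
  have hzero : (WithLp.toLp 2 fun c => (0 : ℝ) ^ (e c : PlaneTree N).order *
      ((e c : PlaneTree N).density : ℝ)⁻¹ : EuclideanSpace ℝ (Fin (Fintype.card S))) = 0 := by
    ext c
    simp [zero_pow (Nat.one_le_iff_ne_zero.1 (e c : PlaneTree N).one_le_order)]
  rw [hzero] at hC
  set a := (t.density : ℝ)⁻¹ - ∑ m, ∑ i, M.b m i * M.planeTheta t m i with ha
  -- In the coordinate of `t` the local error equals `h ^ ρ(t) * a`. Dividing the order bound by `h
  -- ^ ρ(t)` leaves an exponent of at least `1`, which forces `a = 0` in the limit.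
  have hbound : ∀ᶠ h in 𝓝[>] (0 : ℝ), |a| ≤ C * h ^ (p + 1 - t.order) := by
    filter_upwards [hC, self_mem_nhdsWithin] with h hh hpos
    have h1 := hh.2 _ ⟨_, M.isStage_treeSystem e hS h, rfl⟩
    have h2 := (PiLp.norm_apply_le _ (e.symm ⟨t, htS⟩)).trans h1
    simp only [zero_add, PiLp.sub_apply, WithLp.ofLp_sum, Finset.sum_apply, PiLp.smul_apply,
      Equiv.apply_symm_apply, smul_eq_mul] at h2
    have h3 : h ^ t.order * (t.density : ℝ)⁻¹ -
        ∑ m, ∑ i, M.b m i * (h ^ t.order * M.planeTheta t m i) = h ^ t.order * a := by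
      rw [ha, mul_sub, Finset.mul_sum]
      simp only [Finset.mul_sum, mul_left_comm]
    have hp : 0 < h ^ t.order := pow_pos hpos _
    rw [h3, norm_mul, Real.norm_of_nonneg hp.le, Real.norm_eq_abs] at h2
    have h4 : h ^ (p + 1) = h ^ t.order * h ^ (p + 1 - t.order) := by
      rw [← pow_add]
      congr 1
      omega
    rw [h4, mul_left_comm] at h2
    exact le_of_mul_le_mul_left h2 hp
  have hlim : Tendsto (fun h : ℝ => C * h ^ (p + 1 - t.order)) (𝓝[>] 0) (𝓝 0) := by
    have h1 : Continuous fun h : ℝ => C * h ^ (p + 1 - t.order) := by fun_prop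
    have h2 := h1.tendsto 0
    rw [zero_pow (by omega), mul_zero] at h2
    exact h2.mono_left nhdsWithin_le_nhds
  have h0 : a = 0 := abs_nonpos_iff.1 (ge_of_tendsto hlim hbound)
  exact (sub_eq_zero.1 h0).symm

end Necessary

end GarkRos

/-! ### Passage from plane trees to unordered trees. -/

theorem mainTheorem1 {N : ℕ} {s : Fin N → ℕ} (M : GarkRos.Method N s) (p : ℕ) :
    M.HasOrder p ↔
      ∀ t : GarkRos.Tree N, 1 ≤ t.order → t.order ≤ p →
        ∑ m : Fin N, M.b m ⬝ᵥ M.theta m t = 1 / (t.density : ℝ) := by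
  constructor
  · intro hM t _ ht
    induction t using Quotient.inductionOn with
    | h t =>
      rw [one_div]
      exact hM.planeTheta_eq t ht
  · intro hM
    refine M.hasOrder_of_planeTheta fun t ht => ?_
    rw [← one_div]
    exact hM (Quotient.mk _ t) t.one_le_order ht
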